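/- Let $\mathcal H_u$ be a nonzero separable real Hilbert space, $H:\mathcal H_u\to\mathbb R^{N_d}$ a bounded linear operator, $\bm d\in\mathbb R^{N_d}$ and $\tau>0$. Put $\|x\|^2_{\Gamma_{\rm noise}}=\tau\|x\|^2$ (noise covariance $\Gamma_{\rm noise}=\tau^{-1}I$) and $$\Phi(v,\lambda)=\tfrac12\|\bm d-\lambda Hv\|^2_{\Gamma_{\rm noise}},\qquad (v,\lambda)\in\mathcal H_u\times\mathbb R .$$ Let $\mu_0^v=\mathcal N(0,\mathcal C_0)$ with $\mathcal C_0$ symmetric, positive definite and trace class on $\mathcal H_u$, let $\mu_0^\lambda=\mathcal N(\bar\lambda,\sigma)$ with variance $\sigma>0$, let $\mu_0=\mu_0^v\times\mu_0^\lambda$, and let $\mu$ be the posterior, $\frac{d\mu}{d\mu_0}=\frac1{Z_\mu}e^{-\Phi}$ with $Z_\mu=\int e^{-\Phi}\,d\mu_0$. For $N>0$ put $T_N^v=\{v: 1/N\le\|v\|\le N\}$ and $T_N^\lambda=[-N,N]$. Let $\mathcal A_v$ be the set of Borel probability measures $\nu^v$ on $\mathcal H_u$ equivalent to $\mu_0^v$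 for which there is a measurable potential $\Phi_v:\mathcal H_u\to\mathbb R$ with $$\frac{d\nu^v}{d\mu_0^v}=\frac{e^{-\Phi_v}}{\int e^{-\Phi_v}d\mu_0^v},\qquad \sup_{T_N^v}\Phi_v<\infty\ \ (N>0),\qquad \int e^{-\Phi_v(v)}\max(1,\|v\|^2)\,\mu_0^v(dv)<\infty,$$ and let $\mathcal A_\lambda$ be the analogous set of probability measures on $\mathbb R$, with $\mu_0^\lambda$, $T_N^\lambda$ and $\max(1,\lambda^2)$. Then: (1) Every pair $(\nu^v,\nu^\lambda)\in\mathcal A_v\times\mathcal A_\lambda$ satisfies the following conditions: $\sup_N\mu_0^v(T_N^v)=1$ and $\sup_N\mu_0^\lambda(T_N^\lambda)=1$; for every $N>0$, with $A=\{\Phi\ge0\}$, $$\sup_{v\in T_N^v}\int_{\mathbb R}\Phi(v,\lambda)1_A(v,\lambda)\,\nu^\lambda(d\lambda)<\infty,\qquad \sup_{\lambda\in T_N^\lambda}\int_{\mathcal H_u}\Phi(v,\lambda)1_A(v,\lambda)\,\nu^v(dv)<\infty;$$ and $$\int_{\mathcal H_u} e^{-\int\Phi(v,\lambda)\nu^\lambda(d\lambda)}\max(1,\|v\|^2)\,\mu_0^v(dv)<\infty,\qquad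 \int_{\mathbb R} e^{-\int\Phi(v,\lambda)\nu^v(dv)}\max(1,\lambda^2)\,\mu_0^\lambda(d\lambda)<\infty .$$ (2) The mean-field problem $$\min_{\nu^v\in\mathcal A_v,\ \nu^\lambda\in\mathcal A_\lambda} D_{\rm KL}(\nu^v\times\nu^\lambda\,\|\,\mu)$$ has a solution $\nu=\nu^v\times\nu^\lambda$ such that, for some constants $c_v,c_\lambda\in\mathbb R$ and the potentials (given by convergent integrals) $$\Phi_v(v)=\int_{\mathbb R}\Phi(v,\lambda)\,\nu^\lambda(d\lambda)+c_v,\qquad \Phi_\lambda(\lambda)=\int_{\mathcal H_u}\Phi(v,\lambda)\,\nu^v(dv)+c_\lambda,$$ one has $$\frac{d\nu}{d\mu_0}(v,\lambda)\propto e^{-(\Phi_v(v)+\Phi_\lambda(\lambda))},\qquad \frac{d\nu^v}{d\mu_0^v}(v)\propto e^{-\Phi_v(v)},\qquad \frac{d\nu^\lambda}{d\mu_0^\lambda}(\lambda)\propto e^{-\Phi_\lambda(\lambda)} .$$ -/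

import Mathlib

open MeasureTheory ProbabilityTheory InformationTheory
open scoped ENNReal NNReal RealInnerProductSpace

/-- `μ` is the Gaussian measure `N(m, C)` on the Hilbert space `H`: it is Gaussian, its mean is `m`
and its covariance operator is `C`. (Such a `μ` is unique, and it exists exactly when `C` is
symmetric, nonnegative and of trace class, so these properties of `C` need not be stated.) -/
def IsGaussianWith {H : Type*} [NormedAddCommGroup H] [InnerProductSpace ℝ H]
    [MeasurableSpace H] [BorelSpace H] (μ : Measure H) (m : H) (C : H →L[ℝ] H) : Prop :=
  IsGaussian μ ∧ ∫ x, x ∂μ = m ∧ ∀ x y : H, covarianceBilin μ x y = ⟪C x, y⟫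

/-- The negative log-likelihood `Φ(v, l) = ½ ‖d - l H v‖²_Γ` for the noise covariance
`Γ = τ⁻¹ I`, where `‖x‖²_Γ = ‖Γ^{-1/2} x‖² = τ ‖x‖²`. -/
noncomputable def misfit {V : Type*} [NormedAddCommGroup V] [InnerProductSpace ℝ V] {n : ℕ}
    (H : V →L[ℝ] EuclideanSpace ℝ (Fin n)) (d : EuclideanSpace ℝ (Fin n)) (τ : ℝ)
    (p : V × ℝ) : ℝ :=
  (1 / 2) * (τ * ‖d - p.2 • H p.1‖ ^ 2)

/-- The measure with density `exp (-φ) / Z` with respect to `μ₀`, where `Z = ∫ exp (-φ) dμ₀`. -/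
noncomputable def gibbs {X : Type*} [MeasurableSpace X] (μ₀ : Measure X) (φ : X → ℝ) :
    Measure X :=
  μ₀.withDensity (fun x => ENNReal.ofReal (Real.exp (-φ x) / ∫ y, Real.exp (-φ y) ∂μ₀))

/-- `ν` has potential `φ` with respect to `μ₀`: `dν/dμ₀ = exp (-φ) / Z`, where `φ` is measurable
and the normalization constant `Z = ∫ exp (-φ) dμ₀` is finite. -/
def HasPotential {X : Type*} [MeasurableSpace X] (μ₀ : Measure X) (φ : X → ℝ)
    (ν : Measure X) : Prop :=
  Measurable φ ∧ Integrable (fun x => Real.exp (-φ x)) μ₀ ∧ ν = gibbs μ₀ φ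

/-- The set `T_N = {v | 1/N ≤ ‖v‖ ≤ N}`. -/
def annulus (V : Type*) [NormedAddCommGroup V] (N : ℝ) : Set V :=
  {v | 1 / N ≤ ‖v‖ ∧ ‖v‖ ≤ N}

/-- Potentials that are bounded above on each set `T N`, `N > 0`. -/
def PotentialsR1 {X : Type*} (T : ℝ → Set X) : Set (X → ℝ) :=
  {φ | ∀ N : ℝ, 0 < N → BddAbove (φ '' T N)}

/-- Potentials `φ` with `∫ exp (-φ(x)) max(1, ‖x‖²) μ₀(dx) < ∞`. -/
def PotentialsR2 {X : Type*} [NormedAddCommGroup X] [MeasurableSpace X] (μ₀ : Measure X) :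
    Set (X → ℝ) :=
  {φ | ∫⁻ x, ENNReal.ofReal (Real.exp (-φ x) * max 1 (‖x‖ ^ 2)) ∂μ₀ < ⊤}

/-- Probability measures equivalent to `μ₀` that have a potential in `R¹ ∩ R²`. -/
def AdmissibleSet {X : Type*} [NormedAddCommGroup X] [MeasurableSpace X]
    (T : ℝ → Set X) (μ₀ : Measure X) : Set (Measure X) :=
  {ν | IsProbabilityMeasure ν ∧ ν ≪ μ₀ ∧ μ₀ ≪ ν ∧
    ∃ φ : X → ℝ, φ ∈ PotentialsR1 T ∩ PotentialsR2 μ₀ ∧ HasPotential μ₀ φ ν}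

/-- The admissible measures for the parameter `v`. -/
def AdmissibleV {V : Type*} [NormedAddCommGroup V] [MeasurableSpace V] (μ₀ : Measure V) :
    Set (Measure V) :=
  AdmissibleSet (annulus V) μ₀

/-- The admissible measures for the hyper-parameter `l`, where `T_N = [-N, N]`. -/
def AdmissibleL (μ₀ : Measure ℝ) : Set (Measure ℝ) :=
  AdmissibleSet (fun N => Set.Icc (-N) N) μ₀

/-- The conditions on the approximating measures `νv`, `νl` for the likelihood potential `Φ`. -/
structure MeanFieldConditions {V : Type*} [NormedAddCommGroup V] [MeasurableSpace V]
    (Φ : V × ℝ → ℝ) (μv : Measure V) (μl : Measure ℝ) (νv : Measure V) (νl : Measure ℝ) :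
    Prop where
  exhaust_v : ⨆ (N : ℝ) (_ : 0 < N), μv (annulus V N) = 1
  exhaust_l : ⨆ (N : ℝ) (_ : 0 < N), μl (Set.Icc (-N) N) = 1
  T1 : ∀ N : ℝ, 0 < N →
    ⨆ v ∈ annulus V N, ∫⁻ l, ENNReal.ofReal ({p | 0 ≤ Φ p}.indicator Φ (v, l)) ∂νl < ⊤
  T2 : ∀ N : ℝ, 0 < N →
    ⨆ l ∈ Set.Icc (-N) N, ∫⁻ v, ENNReal.ofReal ({p | 0 ≤ Φ p}.indicator Φ (v, l)) ∂νv < ⊤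
  T3 : ∫⁻ v, ENNReal.ofReal (Real.exp (-∫ l, Φ (v, l) ∂νl) * max 1 (‖v‖ ^ 2)) ∂μv < ⊤
  T4 : ∫⁻ l, ENNReal.ofReal (Real.exp (-∫ v, Φ (v, l) ∂νv) * max 1 (l ^ 2)) ∂μl < ⊤

/-- `(νv, νl)` solves the mean-field problem `min KL(νv × νl ‖ μ)` over `Av × Al`. -/
def IsMeanFieldSolution {V : Type*} [MeasurableSpace V] (Av : Set (Measure V))
    (Al : Set (Measure ℝ)) (μ : Measure (V × ℝ)) (νv : Measure V) (νl : Measure ℝ) : Prop :=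
  νv ∈ Av ∧ νl ∈ Al ∧
    ∀ ρv ∈ Av, ∀ ρl ∈ Al, klDiv (νv.prod νl) μ ≤ klDiv (ρv.prod ρl) μ

/-!
The misfit `Φ` is a quadratic polynomial in `l` whose coefficients depend on `v` only through
`⟪d, H v⟫` and `‖H v‖²`. Hence its average over a law of `l` depends on the first two moments of
that law alone, and its average over a law of `v` is a quadratic polynomial in `l` with nonnegative
leading coefficient. Admissible measures have finite second moments, by the condition `R²`, so all
these averages converge; together with `Φ ≥ 0` and the second moments of the Gaussian priors this
yields the conditions on every admissible pair. The annuli exhaust the space up to the origin, which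
is not an atom because `C₀` is positive definite.

For a product measure of finite relative entropy with respect to the posterior, the relative entropy
is, up to the constant `log Z`, the energy `KL(ρv ‖ μv) + KL(ρl ‖ μl) + ∫ Φ d(ρv × ρl)`
(`klDiv_prod_tilted`, `meanFieldEnergy`). With one factor fixed, the Gibbs variational inequality
(`neg_log_integral_exp_le`, with equality case `eq_tilted_of_le`) identifies the optimal other
factor as the Gibbs measure of the averaged misfit. The optimal `ρl` is therefore the Gaussian prior
tilted by a concave quadratic polynomial, hence a Gaussian `N(m, σ eᵗ)`
(`exists_gaussianLogVar_optimal`), and the optimal `ρv` depends only on `(m, t)`. So the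
infimum of the energy is the infimum over the plane of the `reducedEnergy`
`KL(N(m, σ eᵗ) ‖ N(lbar, σ)) - log ∫ exp (-averagedMisfit) dμv`. This function is continuous, and it
is coercive because its second term is nonnegative and the Gaussian relative entropy is explicit
(`le_reducedEnergy`). It has a minimizer, which gives a solution `(νv, νl)` in which `νv` is optimal
for `νl` by construction; `νl` is optimal for `νv` by minimality and the uniqueness in the Gibbs
inequality (`exists_meanFieldEnergy_minimizer`). These two facts are the stated formulas for the
potentials.
-/

/-! ### Gibbs measures and log-likelihood ratios -/

section General

variable {X Y : Type*} [MeasurableSpace X] [MeasurableSpace Y]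

lemma gibbs_eq_tilted (μ₀ : Measure X) (φ : X → ℝ) : gibbs μ₀ φ = μ₀.tilted (fun x => -φ x) := rfl

lemma tilted_add_const (μ₀ : Measure X) (f : X → ℝ) (c : ℝ) :
    μ₀.tilted (fun x => f x + c) = μ₀.tilted f := by
  unfold Measure.tilted
  congr 1
  funext x
  simp_rw [Real.exp_add, integral_mul_const]
  rw [mul_div_mul_right _ _ (Real.exp_ne_zero c)]

lemma integrable_exp_of_nonpos {μ₀ : Measure X} [IsFiniteMeasure μ₀] {f : X → ℝ}
    (hf : Measurable f) (h0 : ∀ x, f x ≤ 0) : Integrable (fun x => Real.exp (f x)) μ₀ :=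
  Integrable.of_bound (by fun_prop) 1 (ae_of_all _ fun x => by simpa using h0 x)

lemma MeasureTheory.Integrable.linear_comb {ρ : Measure X} [IsFiniteMeasure ρ] {f g : X → ℝ}
    (hf : Integrable f ρ) (hg : Integrable g ρ) (a b c : ℝ) :
    Integrable (fun x => a * f x + b * g x + c) ρ :=
  ((hf.const_mul a).add (hg.const_mul b)).add (integrable_const c)

lemma integral_linear_comb {ρ : Measure X} [IsProbabilityMeasure ρ] {f g : X → ℝ}
    (hf : Integrable f ρ) (hg : Integrable g ρ) (a b c : ℝ) :
    ∫ x, (a * f x + b * g x + c) ∂ρ = a * ∫ x, f x ∂ρ + b * ∫ x, g x ∂ρ + c := by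
  have h : Integrable (fun x => a * f x + b * g x) ρ := (hf.const_mul a).add (hg.const_mul b)
  rw [integral_add h (integrable_const c), integral_add (hf.const_mul a) (hg.const_mul b),
    integral_const_mul, integral_const_mul]
  simp

lemma llr_tilted_self {μ₀ : Measure X} [IsFiniteMeasure μ₀] {f : X → ℝ} (hf : Measurable f)
    (hexp : Integrable (fun x => Real.exp (f x)) μ₀) :
    llr (μ₀.tilted f) μ₀ =ᵐ[μ₀.tilted f] fun x => f x - Real.log (∫ z, Real.exp (f z) ∂μ₀) := by
  have h := llr_tilted_left (μ := μ₀) (ν := μ₀) Measure.AbsolutelyContinuous.rfl hexp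
    hf.aemeasurable
  refine (tilted_absolutelyContinuous μ₀ f).ae_le ?_
  filter_upwards [h, llr_self μ₀] with x hx h0
  rw [hx, h0]
  simp

lemma integrable_llr_tilted_self {μ₀ : Measure X} [IsFiniteMeasure μ₀] {f : X → ℝ}
    (hf : Measurable f) (hexp : Integrable (fun x => Real.exp (f x)) μ₀)
    (hint : Integrable f (μ₀.tilted f)) :
    Integrable (llr (μ₀.tilted f) μ₀) (μ₀.tilted f) := by
  rw [integrable_congr (llr_tilted_self hf hexp)]
  exact hint.sub (integrable_const _)

lemma integral_llr_tilted_self {μ₀ : Measure X} [IsProbabilityMeasure μ₀] {f : X → ℝ}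
    (hf : Measurable f) (hexp : Integrable (fun x => Real.exp (f x)) μ₀)
    (hint : Integrable f (μ₀.tilted f)) :
    ∫ x, llr (μ₀.tilted f) μ₀ x ∂μ₀.tilted f =
      ∫ x, f x ∂μ₀.tilted f - Real.log (∫ z, Real.exp (f z) ∂μ₀) := by
  have := isProbabilityMeasure_tilted hexp
  rw [integral_congr_ae (llr_tilted_self hf hexp), integral_sub hint (integrable_const _)]
  simp

/-- The Gibbs variational inequality: the functional `ρ ↦ KL(ρ ‖ μ₀) - ∫ f dρ` is at least
`-log ∫ exp f dμ₀`, which is its value at the tilted measure. It amounts to nonnegativity of the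
relative entropy with respect to the tilted measure. -/
lemma neg_log_integral_exp_le {μ₀ ρ : Measure X} [IsProbabilityMeasure μ₀] [IsProbabilityMeasure ρ]
    {f : X → ℝ} (hac : ρ ≪ μ₀) (hllr : Integrable (llr ρ μ₀) ρ) (hf : Integrable f ρ)
    (hexp : Integrable (fun x => Real.exp (f x)) μ₀) :
    -Real.log (∫ x, Real.exp (f x) ∂μ₀) ≤ ∫ x, llr ρ μ₀ x ∂ρ - ∫ x, f x ∂ρ := by
  have := isProbabilityMeasure_tilted hexp
  have h := integral_llr_tilted_right hac hf hexp hllr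
  have h0 := integral_llr_add_sub_measure_univ_nonneg
    (hac.trans (absolutelyContinuous_tilted hexp)) (integrable_llr_tilted_right hac hf hllr hexp)
  simp only [probReal_univ, add_sub_cancel_right] at h0
  linarith

/-- The equality case of the Gibbs variational inequality. -/
lemma eq_tilted_of_le {μ₀ ρ : Measure X} [IsProbabilityMeasure μ₀] [IsProbabilityMeasure ρ]
    {f : X → ℝ} (hac : ρ ≪ μ₀) (hllr : Integrable (llr ρ μ₀) ρ) (hf : Integrable f ρ)
    (hexp : Integrable (fun x => Real.exp (f x)) μ₀)
    (hle : ∫ x, llr ρ μ₀ x ∂ρ - ∫ x, f x ∂ρ ≤ -Real.log (∫ x, Real.exp (f x) ∂μ₀)) :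
    ρ = μ₀.tilted f := by
  have := isProbabilityMeasure_tilted hexp
  have h := integral_llr_tilted_right hac hf hexp hllr
  rw [← klDiv_eq_zero_iff, klDiv_of_ac_of_integrable
    (hac.trans (absolutelyContinuous_tilted hexp)) (integrable_llr_tilted_right hac hf hllr hexp)]
  simp only [probReal_univ, add_sub_cancel_right, ENNReal.ofReal_eq_zero]
  linarith

lemma llr_prod {μ₁ ρ₁ : Measure X} {μ₂ ρ₂ : Measure Y} [IsProbabilityMeasure μ₁]
    [IsProbabilityMeasure ρ₁] [IsProbabilityMeasure μ₂] [IsProbabilityMeasure ρ₂]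
    (h₁ : ρ₁ ≪ μ₁) (h₂ : ρ₂ ≪ μ₂) :
    llr (ρ₁.prod ρ₂) (μ₁.prod μ₂) =ᵐ[ρ₁.prod ρ₂] fun p => llr ρ₁ μ₁ p.1 + llr ρ₂ μ₂ p.2 := by
  -- The density of the product is the product of the densities.
  have hd : ρ₁.prod ρ₂ = (μ₁.prod μ₂).withDensity
      (fun p => ρ₁.rnDeriv μ₁ p.1 * ρ₂.rnDeriv μ₂ p.2) := by
    rw [← prod_withDensity (Measure.measurable_rnDeriv _ _) (Measure.measurable_rnDeriv _ _),
      Measure.withDensity_rnDeriv_eq _ _ h₁, Measure.withDensity_rnDeriv_eq _ _ h₂]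
  have hr : (ρ₁.prod ρ₂).rnDeriv (μ₁.prod μ₂) =ᵐ[μ₁.prod μ₂]
      fun p => ρ₁.rnDeriv μ₁ p.1 * ρ₂.rnDeriv μ₂ p.2 := by
    conv_lhs => rw [hd]
    exact Measure.rnDeriv_withDensity _ (by fun_prop)
  have hac : ρ₁.prod ρ₂ ≪ μ₁.prod μ₂ := h₁.prod h₂
  filter_upwards [hac.ae_le hr, Measure.quasiMeasurePreserving_fst.ae (Measure.rnDeriv_pos h₁),
    Measure.quasiMeasurePreserving_snd.ae (Measure.rnDeriv_pos h₂),
    Measure.quasiMeasurePreserving_fst.ae (h₁.ae_le (Measure.rnDeriv_lt_top ρ₁ μ₁)),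
    Measure.quasiMeasurePreserving_snd.ae (h₂.ae_le (Measure.rnDeriv_lt_top ρ₂ μ₂))]
    with p hp p1 p2 t1 t2
  simp only [llr, hp, ENNReal.toReal_mul]
  rw [Real.log_mul (ENNReal.toReal_pos p1.ne' t1.ne).ne' (ENNReal.toReal_pos p2.ne' t2.ne).ne']

lemma integrable_of_integrable_add_prod {ρ₁ : Measure X} {ρ₂ : Measure Y} [IsProbabilityMeasure ρ₁]
    [IsProbabilityMeasure ρ₂] {f : X → ℝ} {g : Y → ℝ}
    (h : Integrable (fun p : X × Y => f p.1 + g p.2) (ρ₁.prod ρ₂)) :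
    Integrable f ρ₁ ∧ Integrable g ρ₂ := by
  obtain ⟨x, hx⟩ := h.prod_right_ae.exists
  obtain ⟨y, hy⟩ := h.prod_left_ae.exists
  refine ⟨?_, ?_⟩
  · exact (hy.sub (integrable_const (g y))).congr (ae_of_all _ fun _ => by simp)
  · exact (hx.sub (integrable_const (f x))).congr (ae_of_all _ fun _ => by simp)

lemma integrable_llr_prod_iff {μ₁ ρ₁ : Measure X} {μ₂ ρ₂ : Measure Y} [IsProbabilityMeasure μ₁]
    [IsProbabilityMeasure ρ₁] [IsProbabilityMeasure μ₂] [IsProbabilityMeasure ρ₂]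
    (h₁ : ρ₁ ≪ μ₁) (h₂ : ρ₂ ≪ μ₂) :
    Integrable (llr (ρ₁.prod ρ₂) (μ₁.prod μ₂)) (ρ₁.prod ρ₂) ↔
      Integrable (llr ρ₁ μ₁) ρ₁ ∧ Integrable (llr ρ₂ μ₂) ρ₂ := by
  rw [integrable_congr (llr_prod h₁ h₂)]
  exact ⟨integrable_of_integrable_add_prod, fun h => (h.1.comp_fst ρ₂).add (h.2.comp_snd ρ₁)⟩

lemma integral_llr_prod {μ₁ ρ₁ : Measure X} {μ₂ ρ₂ : Measure Y} [IsProbabilityMeasure μ₁]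
    [IsProbabilityMeasure ρ₁] [IsProbabilityMeasure μ₂] [IsProbabilityMeasure ρ₂]
    (h₁ : ρ₁ ≪ μ₁) (h₂ : ρ₂ ≪ μ₂) (hi₁ : Integrable (llr ρ₁ μ₁) ρ₁)
    (hi₂ : Integrable (llr ρ₂ μ₂) ρ₂) :
    ∫ p, llr (ρ₁.prod ρ₂) (μ₁.prod μ₂) p ∂ρ₁.prod ρ₂ =
      ∫ x, llr ρ₁ μ₁ x ∂ρ₁ + ∫ y, llr ρ₂ μ₂ y ∂ρ₂ := by
  rw [integral_congr_ae (llr_prod h₁ h₂), integral_add (hi₁.comp_fst ρ₂) (hi₂.comp_snd ρ₁),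
    integral_fun_fst, integral_fun_snd]
  simp

/-- A product measure of finite relative entropy with respect to a tilted product measure
has factors of finite relative entropy. -/
lemma integrable_llr_of_klDiv_tilted_ne_top {μ₁ ρ₁ : Measure X} {μ₂ ρ₂ : Measure Y}
    [IsProbabilityMeasure μ₁]
    [IsProbabilityMeasure ρ₁] [IsProbabilityMeasure μ₂] [IsProbabilityMeasure ρ₂]
    (h₁ : ρ₁ ≪ μ₁) (h₂ : ρ₂ ≪ μ₂) {f : X × Y → ℝ} (hf : Integrable f (ρ₁.prod ρ₂))
    (hexp : Integrable (fun p => Real.exp (f p)) (μ₁.prod μ₂))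
    (h : klDiv (ρ₁.prod ρ₂) ((μ₁.prod μ₂).tilted f) ≠ ⊤) :
    Integrable (llr ρ₁ μ₁) ρ₁ ∧ Integrable (llr ρ₂ μ₂) ρ₂ := by
  rw [← integrable_llr_prod_iff h₁ h₂]
  have hi := (klDiv_ne_top_iff.1 h).2
  rw [integrable_congr (llr_tilted_right (h₁.prod h₂) hexp)] at hi
  refine (hi.sub (hf.neg.add (integrable_const
    (Real.log (∫ z, Real.exp (f z) ∂μ₁.prod μ₂))))).congr (ae_of_all _ fun p => ?_)
  simp

lemma klDiv_prod_tilted {μ₁ ρ₁ : Measure X} {μ₂ ρ₂ : Measure Y} [IsProbabilityMeasure μ₁]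
    [IsProbabilityMeasure ρ₁] [IsProbabilityMeasure μ₂] [IsProbabilityMeasure ρ₂]
    (h₁ : ρ₁ ≪ μ₁) (h₂ : ρ₂ ≪ μ₂) (hi₁ : Integrable (llr ρ₁ μ₁) ρ₁)
    (hi₂ : Integrable (llr ρ₂ μ₂) ρ₂) {f : X × Y → ℝ} (hf : Integrable f (ρ₁.prod ρ₂))
    (hexp : Integrable (fun p => Real.exp (f p)) (μ₁.prod μ₂)) :
    klDiv (ρ₁.prod ρ₂) ((μ₁.prod μ₂).tilted f) = ENNReal.ofReal
      (∫ x, llr ρ₁ μ₁ x ∂ρ₁ + ∫ y, llr ρ₂ μ₂ y ∂ρ₂ - ∫ p, f p ∂ρ₁.prod ρ₂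
        + Real.log (∫ p, Real.exp (f p) ∂μ₁.prod μ₂)) := by
  have := isProbabilityMeasure_tilted hexp
  have hi := (integrable_llr_prod_iff h₁ h₂).2 ⟨hi₁, hi₂⟩
  rw [klDiv_of_ac_of_integrable ((h₁.prod h₂).trans (absolutelyContinuous_tilted hexp))
    (integrable_llr_tilted_right (h₁.prod h₂) hf hi hexp),
    integral_llr_tilted_right (h₁.prod h₂) hf hexp hi, integral_llr_prod h₁ h₂ hi₁ hi₂]
  simp

lemma gibbs_prod (μ₁ : Measure X) (μ₂ : Measure Y) [IsFiniteMeasure μ₁]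
    [IsFiniteMeasure μ₂] {φ : X → ℝ} {ψ : Y → ℝ} (hφ : Measurable φ) (hψ : Measurable ψ) :
    (gibbs μ₁ φ).prod (gibbs μ₂ ψ) = gibbs (μ₁.prod μ₂) (fun p => φ p.1 + ψ p.2) := by
  unfold gibbs
  rw [prod_withDensity (by fun_prop) (by fun_prop)]
  congr 1
  funext p
  have : ∫ q, Real.exp (-(φ q.1 + ψ q.2)) ∂μ₁.prod μ₂ =
      (∫ x, Real.exp (-φ x) ∂μ₁) * ∫ y, Real.exp (-ψ y) ∂μ₂ := by
    rw [← integral_prod_mul]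
    simp_rw [neg_add, Real.exp_add]
  rw [this, ← ENNReal.ofReal_mul (by positivity), neg_add, Real.exp_add, mul_div_mul_comm]

lemma HasPotential.prod {μ₁ ν₁ : Measure X} {μ₂ ν₂ : Measure Y} [IsFiniteMeasure μ₁]
    [IsFiniteMeasure μ₂] {φ : X → ℝ} {ψ : Y → ℝ} (h₁ : HasPotential μ₁ φ ν₁)
    (h₂ : HasPotential μ₂ ψ ν₂) :
    HasPotential (μ₁.prod μ₂) (fun p => φ p.1 + ψ p.2) (ν₁.prod ν₂) := by
  obtain ⟨m₁, i₁, rfl⟩ := h₁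
  obtain ⟨m₂, i₂, rfl⟩ := h₂
  refine ⟨by fun_prop, ?_, gibbs_prod μ₁ μ₂ m₁ m₂⟩
  simp_rw [neg_add, Real.exp_add]
  exact i₁.mul_prod i₂

end General

/-! ### Second moments of admissible measures -/

section Moments

variable {X : Type*} [NormedAddCommGroup X] [MeasurableSpace X] [BorelSpace X]
  [SecondCountableTopology X]

lemma memLp_two_tilted_of_nonpos {μ₀ : Measure X} [IsProbabilityMeasure μ₀] {f : X → ℝ}
    (hf : Measurable f) (h0 : ∀ x, f x ≤ 0) (h2 : MemLp id 2 μ₀) :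
    MemLp id 2 (μ₀.tilted f) := by
  refine (memLp_two_iff_integrable_sq_norm (by fun_prop)).2 ?_
  rw [integrable_tilted_iff (integrable_exp_of_nonpos hf h0)]
  refine ((memLp_two_iff_integrable_sq_norm (by fun_prop)).1 h2).mono (by fun_prop)
    (ae_of_all _ fun x => ?_)
  have : Real.exp (f x) ≤ 1 := by simpa using h0 x
  simp only [smul_eq_mul, norm_mul, Real.norm_eq_abs, Real.abs_exp]
  exact mul_le_of_le_one_left (abs_nonneg _) this

lemma lintegral_max_one_sq_norm_lt_top {μ₀ : Measure X} [IsProbabilityMeasure μ₀]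
    (h2 : MemLp id 2 μ₀) :
    ∫⁻ x, ENNReal.ofReal (max 1 (‖x‖ ^ 2)) ∂μ₀ < ⊤ := by
  have h := (memLp_two_iff_integrable_sq_norm (by fun_prop)).1 h2
  exact ((integrable_const (1 : ℝ)).sup h).lintegral_lt_top

lemma mem_potentialsR2_of_nonneg {μ₀ : Measure X} [IsProbabilityMeasure μ₀] (h2 : MemLp id 2 μ₀)
    {φ : X → ℝ} (h0 : ∀ x, 0 ≤ φ x) : φ ∈ PotentialsR2 μ₀ := by
  refine lt_of_le_of_lt (lintegral_mono fun x => ENNReal.ofReal_le_ofReal ?_)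
    (lintegral_max_one_sq_norm_lt_top h2)
  exact mul_le_of_le_one_left (by positivity) (by simpa using h0 x)

lemma memLp_two_of_mem_admissibleSet {T : ℝ → Set X} {μ₀ ν : Measure X}
    (hν : ν ∈ AdmissibleSet T μ₀) : MemLp id 2 ν := by
  obtain ⟨_, _, _, φ, ⟨_, hR2⟩, hm, hexp, rfl⟩ := hν
  -- The condition `R²` says precisely that `max 1 ‖x‖²` is integrable for the Gibbs measure.
  refine (memLp_two_iff_integrable_sq_norm (by fun_prop)).2 ?_
  rw [gibbs_eq_tilted, integrable_tilted_iff hexp]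
  refine ⟨by fun_prop, ?_⟩
  rw [hasFiniteIntegral_iff_norm]
  refine lt_of_le_of_lt (lintegral_mono fun x => ENNReal.ofReal_le_ofReal ?_) hR2
  simp only [smul_eq_mul, norm_mul, Real.norm_eq_abs, Real.abs_exp, id, abs_pow, abs_norm]
  gcongr
  exact le_max_right _ _

end Moments

/-! ### One-dimensional Gaussians as tilted Gaussians -/

section Gaussian

/-- The logarithm, up to an additive constant, of the density of `N(m, s)` with respect to
`N(lbar, σ)`. -/
noncomputable def gaussianLogDensity (lbar : ℝ) (σ : ℝ≥0) (m : ℝ) (s : ℝ≥0) (x : ℝ) : ℝ :=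
  (x - lbar) ^ 2 / (2 * σ) - (x - m) ^ 2 / (2 * s)

variable (lbar m : ℝ) {σ s : ℝ≥0}

@[fun_prop]
lemma measurable_gaussianLogDensity (σ s : ℝ≥0) : Measurable (gaussianLogDensity lbar σ m s) := by
  unfold gaussianLogDensity; fun_prop

lemma gaussianPDF_mul_exp_logDensity (hσ : σ ≠ 0) (hs : s ≠ 0) (x : ℝ) :
    gaussianPDF lbar σ x * ENNReal.ofReal (Real.exp (gaussianLogDensity lbar σ m s x)) =
      ENNReal.ofReal (√(s / σ)) * gaussianPDF m s x := by
  have hσ' : (0 : ℝ) < σ := by positivity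
  have hs' : (0 : ℝ) < s := by positivity
  simp only [gaussianPDF, gaussianPDFReal, gaussianLogDensity]
  rw [← ENNReal.ofReal_mul (by positivity), ← ENNReal.ofReal_mul (by positivity), mul_assoc,
    ← Real.exp_add, ← mul_assoc]
  congr 2
  · rw [Real.sqrt_div hs'.le, Real.sqrt_mul (by positivity), Real.sqrt_mul (by positivity) (s : ℝ)]
    have := (Real.sqrt_pos.2 hσ').ne'
    have := (Real.sqrt_pos.2 hs').ne'
    field_simp
  · congr 1
    ring

lemma lintegral_exp_gaussianLogDensity (hσ : σ ≠ 0) (hs : s ≠ 0) :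
    ∫⁻ x, ENNReal.ofReal (Real.exp (gaussianLogDensity lbar σ m s x)) ∂gaussianReal lbar σ =
      ENNReal.ofReal (√(s / σ)) := by
  rw [gaussianReal_of_var_ne_zero _ hσ,
    lintegral_withDensity_eq_lintegral_mul _ (measurable_gaussianPDF _ _) (by fun_prop)]
  simp_rw [Pi.mul_apply, gaussianPDF_mul_exp_logDensity lbar m hσ hs]
  rw [lintegral_const_mul _ (measurable_gaussianPDF _ _), lintegral_gaussianPDF_eq_one _ hs,
    mul_one]

lemma integrable_exp_gaussianLogDensity (hσ : σ ≠ 0) (hs : s ≠ 0) :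
    Integrable (fun x => Real.exp (gaussianLogDensity lbar σ m s x)) (gaussianReal lbar σ) := by
  refine ⟨by fun_prop, ?_⟩
  rw [hasFiniteIntegral_iff_ofReal (ae_of_all _ fun x => (Real.exp_pos _).le),
    lintegral_exp_gaussianLogDensity lbar m hσ hs]
  exact ENNReal.ofReal_lt_top

lemma integral_exp_gaussianLogDensity (hσ : σ ≠ 0) (hs : s ≠ 0) :
    ∫ x, Real.exp (gaussianLogDensity lbar σ m s x) ∂gaussianReal lbar σ = √(s / σ) := by
  rw [integral_eq_lintegral_of_nonneg_ae (ae_of_all _ fun x => (Real.exp_pos _).le) (by fun_prop),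
    lintegral_exp_gaussianLogDensity lbar m hσ hs, ENNReal.toReal_ofReal (by positivity)]

lemma gaussianReal_tilted (hσ : σ ≠ 0) (hs : s ≠ 0) :
    (gaussianReal lbar σ).tilted (gaussianLogDensity lbar σ m s) = gaussianReal m s := by
  have hσ' : (0 : ℝ) < σ := by positivity
  have hs' : (0 : ℝ) < s := by positivity
  have hpos : 0 < √((s : ℝ) / σ) := by positivity
  rw [Measure.tilted, integral_exp_gaussianLogDensity lbar m hσ hs,
    gaussianReal_of_var_ne_zero _ hσ, gaussianReal_of_var_ne_zero _ hs,
    ← withDensity_mul _ (measurable_gaussianPDF _ _) (by fun_prop)]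
  congr 1
  funext x
  rw [Pi.mul_apply, ENNReal.ofReal_div_of_pos hpos, div_eq_mul_inv, ← mul_assoc,
    gaussianPDF_mul_exp_logDensity lbar m hσ hs, mul_right_comm, ENNReal.mul_inv_cancel
      (by simpa using hpos) ENNReal.ofReal_ne_top, one_mul]

lemma integrable_gaussianReal_id (s : ℝ≥0) : Integrable (fun x => x) (gaussianReal m s) :=
  (memLp_id_gaussianReal 1).integrable le_rfl

lemma integrable_gaussianReal_sq (s : ℝ≥0) : Integrable (fun x => x ^ 2) (gaussianReal m s) :=
  (memLp_id_gaussianReal 2).integrable_sq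

lemma integral_gaussianReal_sq (s : ℝ≥0) : ∫ x, x ^ 2 ∂gaussianReal m s = m ^ 2 + s := by
  have h := variance_eq_sub (memLp_id_gaussianReal (μ := m) (v := s) 2)
  rw [variance_id_gaussianReal] at h
  simp only [Pi.pow_apply, id, integral_id_gaussianReal] at h
  linarith

lemma gaussianLogDensity_eq_quadratic (σ s : ℝ≥0) (x : ℝ) :
    gaussianLogDensity lbar σ m s x = ((2 * σ : ℝ)⁻¹ - (2 * s : ℝ)⁻¹) * x ^ 2
      + (m / s - lbar / σ) * x + (lbar ^ 2 / (2 * σ) - m ^ 2 / (2 * s)) := by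
  unfold gaussianLogDensity
  simp only [div_eq_mul_inv, mul_inv]
  ring

lemma integrable_gaussianLogDensity (σ s : ℝ≥0) :
    Integrable (gaussianLogDensity lbar σ m s) (gaussianReal m s) := by
  rw [funext (gaussianLogDensity_eq_quadratic lbar m σ s)]
  exact (integrable_gaussianReal_sq m s).linear_comb (integrable_gaussianReal_id m s) _ _ _

lemma integral_gaussianLogDensity (hσ : σ ≠ 0) (hs : s ≠ 0) :
    ∫ x, gaussianLogDensity lbar σ m s x ∂gaussianReal m s =
      (s / σ + (m - lbar) ^ 2 / σ - 1) / 2 := by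
  have hσ' : (0 : ℝ) < σ := by positivity
  have hs' : (0 : ℝ) < s := by positivity
  simp_rw [gaussianLogDensity_eq_quadratic]
  rw [integral_linear_comb (integrable_gaussianReal_sq m s) (integrable_gaussianReal_id m s),
    integral_gaussianReal_sq, integral_id_gaussianReal]
  field_simp
  ring

/-- The Gaussian `N(m, σ eᵗ)`. The variance is written relative to `σ` on a logarithmic scale, so
that the pair `(m, t)` ranges over the whole plane. -/
noncomputable def gaussianLogVar (σ : ℝ≥0) (m t : ℝ) : Measure ℝ :=
  gaussianReal m (σ * (Real.exp t).toNNReal)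

instance (σ : ℝ≥0) (t : ℝ) : IsProbabilityMeasure (gaussianLogVar σ m t) := by
  unfold gaussianLogVar; infer_instance

lemma coe_mul_exp_toNNReal (σ : ℝ≥0) (t : ℝ) :
    ((σ * (Real.exp t).toNNReal : ℝ≥0) : ℝ) = σ * Real.exp t := by
  simp [Real.exp_nonneg]

lemma mul_exp_toNNReal_ne_zero (hσ : σ ≠ 0) (t : ℝ) : σ * (Real.exp t).toNNReal ≠ 0 :=
  mul_ne_zero hσ (by simpa using Real.exp_pos t)

lemma memLp_two_gaussianLogVar (σ : ℝ≥0) (t : ℝ) : MemLp id 2 (gaussianLogVar σ m t) :=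
  memLp_id_gaussianReal 2

lemma gaussianLogVar_absolutelyContinuous (hσ : σ ≠ 0) (t : ℝ) :
    gaussianLogVar σ m t ≪ gaussianReal lbar σ :=
  (gaussianReal_absolutelyContinuous _ (mul_exp_toNNReal_ne_zero hσ t)).trans
    (gaussianReal_absolutelyContinuous' _ hσ)

lemma integrable_llr_gaussianLogVar (hσ : σ ≠ 0) (t : ℝ) :
    Integrable (llr (gaussianLogVar σ m t) (gaussianReal lbar σ)) (gaussianLogVar σ m t) := by
  have hs := mul_exp_toNNReal_ne_zero hσ t
  have h := integrable_llr_tilted_self (measurable_gaussianLogDensity lbar m _ _)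
    (integrable_exp_gaussianLogDensity lbar m hσ hs)
  rw [gaussianReal_tilted lbar m hσ hs] at h
  exact h (integrable_gaussianLogDensity _ _ _ _)

/-- The relative entropy of `N(m, σ eᵗ)` with respect to `N(lbar, σ)`. -/
lemma integral_llr_gaussianLogVar (hσ : σ ≠ 0) (t : ℝ) :
    ∫ x, llr (gaussianLogVar σ m t) (gaussianReal lbar σ) x ∂gaussianLogVar σ m t =
      (Real.exp t + (m - lbar) ^ 2 / σ - 1 - t) / 2 := by
  have hs := mul_exp_toNNReal_ne_zero hσ t
  have hσ' : (σ : ℝ) ≠ 0 := by positivity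
  have h := integral_llr_tilted_self (measurable_gaussianLogDensity lbar m _ _)
    (integrable_exp_gaussianLogDensity lbar m hσ hs)
  rw [gaussianReal_tilted lbar m hσ hs] at h
  rw [gaussianLogVar, h (integrable_gaussianLogDensity _ _ _ _),
    integral_gaussianLogDensity lbar m hσ hs, integral_exp_gaussianLogDensity lbar m hσ hs,
    coe_mul_exp_toNNReal, mul_div_cancel_left₀ _ hσ', Real.log_sqrt (Real.exp_pos t).le,
    Real.log_exp]
  ring

lemma integral_id_gaussianLogVar (σ : ℝ≥0) (t : ℝ) : ∫ x, x ∂gaussianLogVar σ m t = m :=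
  integral_id_gaussianReal

lemma integral_sq_gaussianLogVar (σ : ℝ≥0) (t : ℝ) :
    ∫ x, x ^ 2 ∂gaussianLogVar σ m t = m ^ 2 + σ * Real.exp t := by
  rw [gaussianLogVar, integral_gaussianReal_sq, coe_mul_exp_toNNReal]

/-- A Gaussian tilted by a concave quadratic polynomial is Gaussian. -/
lemma exists_gaussianLogVar_eq_tilted (hσ : σ ≠ 0) (a c : ℝ) {b : ℝ} (hb : 0 ≤ b) :
    ∃ m t : ℝ, (gaussianReal lbar σ).tilted (fun x => -(b * x ^ 2 / 2 - a * x + c)) =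
      gaussianLogVar σ m t := by
  have hσ' : (0 : ℝ) < σ := by positivity
  have hp : 0 < 1 + σ * b := by positivity
  -- Precisions add, so the new variance is `σ / (1 + σ b)`.
  set t := -Real.log (1 + σ * b) with ht
  have het : Real.exp t = (1 + σ * b)⁻¹ := by rw [ht, Real.exp_neg, Real.exp_log hp]
  set m := (lbar + σ * a) * (1 + σ * b)⁻¹ with hm
  refine ⟨m, t, ?_⟩
  have hs := mul_exp_toNNReal_ne_zero hσ t
  rw [gaussianLogVar, ← gaussianReal_tilted lbar m hσ hs,
    ← tilted_add_const _ _ (c + (lbar ^ 2 / (2 * σ) - m ^ 2 / (2 * (σ * Real.exp t))))]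
  congr 1
  funext x
  rw [gaussianLogDensity_eq_quadratic, coe_mul_exp_toNNReal, het, hm]
  field_simp
  ring

end Gaussian

/-! ### The misfit and its averages -/

section Misfit

variable {V : Type*} [NormedAddCommGroup V] [InnerProductSpace ℝ V] {n : ℕ}
  (H : V →L[ℝ] EuclideanSpace ℝ (Fin n)) (d : EuclideanSpace ℝ (Fin n)) (τ : ℝ)

/-- The average of the misfit over a parameter `l` with first moment `m₁` and second
moment `m₂`. -/
noncomputable def averagedMisfit (m₁ m₂ : ℝ) (v : V) : ℝ :=
  τ / 2 * (‖d‖ ^ 2 - 2 * m₁ * ⟪d, H v⟫ + m₂ * ‖H v‖ ^ 2)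

lemma misfit_eq_averagedMisfit (v : V) (l : ℝ) :
    misfit H d τ (v, l) = averagedMisfit H d τ l (l ^ 2) v := by
  simp only [misfit, averagedMisfit, norm_sub_sq_real, inner_smul_right, norm_smul, mul_pow,
    Real.norm_eq_abs, sq_abs]
  ring

lemma misfit_nonneg {τ : ℝ} (hτ : 0 < τ) (p : V × ℝ) : 0 ≤ misfit H d τ p := by
  unfold misfit; positivity

lemma averagedMisfit_nonneg {τ : ℝ} (hτ : 0 < τ) {m₁ m₂ : ℝ} (h : m₁ ^ 2 ≤ m₂) (v : V) :
    0 ≤ averagedMisfit H d τ m₁ m₂ v := by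
  have h0 := misfit_nonneg H d hτ (v, m₁)
  rw [misfit_eq_averagedMisfit] at h0
  refine h0.trans ?_
  unfold averagedMisfit
  gcongr

lemma continuous_averagedMisfit (m₁ m₂ : ℝ) : Continuous (averagedMisfit H d τ m₁ m₂) := by
  unfold averagedMisfit; fun_prop

lemma continuous_misfit : Continuous (misfit H d τ) := by
  unfold misfit; fun_prop

lemma averagedMisfit_le {τ : ℝ} (hτ : 0 < τ) {m₁ m₂ : ℝ} (h : m₁ ^ 2 ≤ m₂) (v : V) :
    averagedMisfit H d τ m₁ m₂ v ≤ τ * (‖d‖ ^ 2 + m₂ * (‖H‖ * ‖v‖) ^ 2) := by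
  -- Changing the sign of `m₁` gives a nonnegative quantity that cancels the cross term.
  have h0 := misfit_nonneg H d hτ (v, -m₁)
  rw [misfit_eq_averagedMisfit] at h0
  have h1 : ‖H v‖ ^ 2 ≤ (‖H‖ * ‖v‖) ^ 2 := by gcongr; exact H.le_opNorm v
  have h2 : m₂ * ‖H v‖ ^ 2 ≤ m₂ * (‖H‖ * ‖v‖) ^ 2 :=
    mul_le_mul_of_nonneg_left h1 ((sq_nonneg _).trans h)
  have h3 : m₁ ^ 2 * ‖H v‖ ^ 2 ≤ m₂ * ‖H v‖ ^ 2 := mul_le_mul_of_nonneg_right h (sq_nonneg _)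
  have h4 : averagedMisfit H d τ m₁ m₂ v + averagedMisfit H d τ (-m₁) ((-m₁) ^ 2) v ≤
      τ * (‖d‖ ^ 2 + m₂ * (‖H‖ * ‖v‖) ^ 2) := by
    unfold averagedMisfit
    have h5 : 0 ≤ τ * ((m₂ * (‖H‖ * ‖v‖) ^ 2 - m₂ * ‖H v‖ ^ 2) +
        (m₂ * ‖H v‖ ^ 2 - m₁ ^ 2 * ‖H v‖ ^ 2) / 2) :=
      mul_nonneg hτ.le (by linarith)
    linarith
  linarith

lemma sq_integral_le {ρ : Measure ℝ} [IsProbabilityMeasure ρ] (h2 : MemLp id 2 ρ) :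
    (∫ l, l ∂ρ) ^ 2 ≤ ∫ l, l ^ 2 ∂ρ := by
  have h := variance_eq_sub h2
  have h0 := variance_nonneg id ρ
  simp only [Pi.pow_apply, id] at h
  linarith

section AverageL

variable {ρl : Measure ℝ} [IsProbabilityMeasure ρl]

lemma integrable_id_of_memLp (hl : MemLp id 2 ρl) : Integrable (fun l => l) ρl :=
  hl.integrable (by norm_num)

lemma integrable_misfit_right (hl : MemLp id 2 ρl) (v : V) :
    Integrable (fun l => misfit H d τ (v, l)) ρl := by
  refine (hl.integrable_sq.linear_comb (integrable_id_of_memLp hl) (τ / 2 * ‖H v‖ ^ 2)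
    (-(τ * ⟪d, H v⟫)) (τ / 2 * ‖d‖ ^ 2)).congr (ae_of_all _ fun l => ?_)
  simp only [misfit_eq_averagedMisfit, averagedMisfit, id]
  ring

lemma integral_misfit_right (hl : MemLp id 2 ρl) (v : V) :
    ∫ l, misfit H d τ (v, l) ∂ρl = averagedMisfit H d τ (∫ l, l ∂ρl) (∫ l, l ^ 2 ∂ρl) v := by
  have h := integral_linear_comb hl.integrable_sq (integrable_id_of_memLp hl) (τ / 2 * ‖H v‖ ^ 2)
    (-(τ * ⟪d, H v⟫)) (τ / 2 * ‖d‖ ^ 2)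
  simp only [id] at h
  rw [averagedMisfit, show τ / 2 * (‖d‖ ^ 2 - 2 * (∫ l, l ∂ρl) * ⟪d, H v⟫ +
    (∫ l, l ^ 2 ∂ρl) * ‖H v‖ ^ 2) = τ / 2 * ‖H v‖ ^ 2 * ∫ l, l ^ 2 ∂ρl +
    -(τ * ⟪d, H v⟫) * ∫ l, l ∂ρl + τ / 2 * ‖d‖ ^ 2 by ring, ← h]
  refine integral_congr_ae (ae_of_all _ fun l => ?_)
  simp only [misfit_eq_averagedMisfit, averagedMisfit]
  ring

end AverageL

section AverageV

variable [MeasurableSpace V] {ρv : Measure V}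

lemma integrable_sq_norm_map [BorelSpace V] (hv : MemLp id 2 ρv) :
    Integrable (fun v => ‖H v‖ ^ 2) ρv :=
  (memLp_two_iff_integrable_sq_norm (by fun_prop)).1 (H.comp_memLp' hv)

variable [IsProbabilityMeasure ρv]

lemma integrable_inner_map (hv : MemLp id 2 ρv) : Integrable (fun v => ⟪d, H v⟫) ρv :=
  ((H.comp_memLp' hv).integrable (by norm_num)).const_inner d

variable [BorelSpace V]

lemma integrable_misfit_left (hv : MemLp id 2 ρv) (l : ℝ) :
    Integrable (fun v => misfit H d τ (v, l)) ρv := by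
  refine ((integrable_sq_norm_map H hv).linear_comb (integrable_inner_map H d hv) (τ / 2 * l ^ 2)
    (-(τ * l)) (τ / 2 * ‖d‖ ^ 2)).congr (ae_of_all _ fun v => ?_)
  simp only [misfit_eq_averagedMisfit, averagedMisfit]
  ring

lemma integral_misfit_left (hv : MemLp id 2 ρv) (l : ℝ) :
    ∫ v, misfit H d τ (v, l) ∂ρv = (τ * ∫ v, ‖H v‖ ^ 2 ∂ρv) * l ^ 2 / 2
      - (τ * ∫ v, ⟪d, H v⟫ ∂ρv) * l + τ / 2 * ‖d‖ ^ 2 := by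
  have h := integral_linear_comb (integrable_sq_norm_map H hv) (integrable_inner_map H d hv)
    (τ / 2 * l ^ 2) (-(τ * l)) (τ / 2 * ‖d‖ ^ 2)
  rw [show (τ * ∫ v, ‖H v‖ ^ 2 ∂ρv) * l ^ 2 / 2
      - (τ * ∫ v, ⟪d, H v⟫ ∂ρv) * l + τ / 2 * ‖d‖ ^ 2 = τ / 2 * l ^ 2 * (∫ v, ‖H v‖ ^ 2 ∂ρv) +
      -(τ * l) * (∫ v, ⟪d, H v⟫ ∂ρv) + τ / 2 * ‖d‖ ^ 2 by ring, ← h]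
  refine integral_congr_ae (ae_of_all _ fun v => ?_)
  simp only [misfit_eq_averagedMisfit, averagedMisfit]
  ring

lemma integrable_misfit_prod (hv : MemLp id 2 ρv) {ρl : Measure ℝ} [IsProbabilityMeasure ρl]
    (hl : MemLp id 2 ρl) :
    Integrable (misfit H d τ) (ρv.prod ρl) := by
  refine (((integrable_sq_norm_map H hv).mul_prod hl.integrable_sq).linear_comb
    ((integrable_inner_map H d hv).mul_prod (integrable_id_of_memLp hl)) (τ / 2)
    (-τ) (τ / 2 * ‖d‖ ^ 2)).congr (ae_of_all _ fun p => ?_)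
  rw [show p = (p.1, p.2) from rfl, misfit_eq_averagedMisfit, averagedMisfit]
  simp only [id]
  ring

end AverageV

end Misfit

/-! ### Reduction of the mean-field problem to two real parameters -/

section Energy

/-- Probability measures of finite entropy relative to `μ₀` and of finite second moment. -/
structure FiniteEntropy {X : Type*} [NormedAddCommGroup X] [MeasurableSpace X]
    (μ₀ ρ : Measure X) : Prop where
  prob : IsProbabilityMeasure ρ
  ac : ρ ≪ μ₀
  llr_integrable : Integrable (llr ρ μ₀) ρ
  memLp : MemLp id 2 ρ

variable {V : Type*} [NormedAddCommGroup V] [InnerProductSpace ℝ V] {n : ℕ}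
  (H : V →L[ℝ] EuclideanSpace ℝ (Fin n)) (d : EuclideanSpace ℝ (Fin n)) (τ : ℝ)
  [MeasurableSpace V]

/-- The relative entropy of `ρv × ρl` with respect to the posterior, up to the additive constant
`log Z`. -/
noncomputable def meanFieldEnergy (μv : Measure V) (μl : Measure ℝ) (ρv : Measure V)
    (ρl : Measure ℝ) : ℝ :=
  ∫ v, llr ρv μv v ∂ρv + ∫ l, llr ρl μl l ∂ρl + ∫ p, misfit H d τ p ∂ρv.prod ρl

/-- The minimum over `ρv` of the mean-field energy of `(ρv, N(m, σ eᵗ))`: the relative entropy of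
`N(m, σ eᵗ)` minus the logarithm of the partition function of the averaged misfit. -/
noncomputable def reducedEnergy (μv : Measure V) (lbar : ℝ) (σ : ℝ≥0) (q : ℝ × ℝ) : ℝ :=
  (Real.exp q.2 + (q.1 - lbar) ^ 2 / σ - 1 - q.2) / 2 -
    Real.log (∫ v, Real.exp (-averagedMisfit H d τ q.1 (q.1 ^ 2 + σ * Real.exp q.2) v) ∂μv)

lemma sq_le_sq_add_mul_exp (σ : ℝ≥0) (m t : ℝ) : m ^ 2 ≤ m ^ 2 + σ * Real.exp t :=
  le_add_of_nonneg_right (by positivity)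

lemma finiteEntropy_gaussianLogVar {lbar : ℝ} {σ : ℝ≥0} (hσ : σ ≠ 0) (m t : ℝ) :
    FiniteEntropy (gaussianReal lbar σ) (gaussianLogVar σ m t) :=
  ⟨inferInstance, gaussianLogVar_absolutelyContinuous lbar m hσ t,
    integrable_llr_gaussianLogVar lbar m hσ t, memLp_two_gaussianLogVar m σ t⟩

variable [BorelSpace V]

lemma integrable_exp_neg_averagedMisfit (μv : Measure V) [IsProbabilityMeasure μv] {τ : ℝ}
    (hτ : 0 < τ) {m₁ m₂ : ℝ} (h : m₁ ^ 2 ≤ m₂) :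
    Integrable (fun v => Real.exp (-averagedMisfit H d τ m₁ m₂ v)) μv :=
  integrable_exp_of_nonpos (continuous_averagedMisfit H d τ m₁ m₂).neg.measurable
    fun v => neg_nonpos.2 (averagedMisfit_nonneg H d hτ h v)

lemma averagedMisfit_integrable {ρv : Measure V} [IsProbabilityMeasure ρv] (hv : MemLp id 2 ρv)
    (m₁ m₂ : ℝ) : Integrable (averagedMisfit H d τ m₁ m₂) ρv := by
  refine ((integrable_sq_norm_map H hv).linear_comb (integrable_inner_map H d hv) (τ / 2 * m₂)
    (-(τ * m₁)) (τ / 2 * ‖d‖ ^ 2)).congr (ae_of_all _ fun v => ?_)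
  simp only [averagedMisfit]
  ring

lemma meanFieldEnergy_gaussianLogVar (μv : Measure V) {ρv : Measure V} [IsProbabilityMeasure ρv]
    (hv : MemLp id 2 ρv) (lbar : ℝ) {σ : ℝ≥0} (hσ : σ ≠ 0) (m t : ℝ) :
    meanFieldEnergy H d τ μv (gaussianReal lbar σ) ρv (gaussianLogVar σ m t) =
      ∫ v, llr ρv μv v ∂ρv + (Real.exp t + (m - lbar) ^ 2 / σ - 1 - t) / 2 +
        ∫ v, averagedMisfit H d τ m (m ^ 2 + σ * Real.exp t) v ∂ρv := by
  have hl := memLp_two_gaussianLogVar m σ t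
  rw [meanFieldEnergy, integral_llr_gaussianLogVar lbar m hσ,
    integral_prod _ (integrable_misfit_prod H d τ hv hl)]
  simp_rw [integral_misfit_right H d τ hl, integral_id_gaussianLogVar, integral_sq_gaussianLogVar]

lemma reducedEnergy_le {μv : Measure V} [IsProbabilityMeasure μv] {τ : ℝ} (hτ : 0 < τ)
    (lbar : ℝ) {σ : ℝ≥0} (hσ : σ ≠ 0) (m t : ℝ) {ρv : Measure V} (hv : FiniteEntropy μv ρv) :
    reducedEnergy H d τ μv lbar σ (m, t) ≤
      meanFieldEnergy H d τ μv (gaussianReal lbar σ) ρv (gaussianLogVar σ m t) := by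
  have := hv.prob
  have h := neg_log_integral_exp_le hv.ac hv.llr_integrable
    (averagedMisfit_integrable H d τ hv.memLp m (m ^ 2 + σ * Real.exp t)).neg
    (integrable_exp_neg_averagedMisfit H d μv hτ (sq_le_sq_add_mul_exp σ m t))
  rw [meanFieldEnergy_gaussianLogVar H d τ μv hv.memLp lbar hσ, reducedEnergy]
  simp only [Pi.neg_apply, integral_neg] at h ⊢
  linarith

/-- The minimizer of the mean-field energy over `ρv` for fixed `ρl = N(m, σ eᵗ)`. -/
noncomputable def optimalV (μv : Measure V) (σ : ℝ≥0) (m t : ℝ) : Measure V :=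
  μv.tilted fun v => -averagedMisfit H d τ m (m ^ 2 + σ * Real.exp t) v

lemma finiteEntropy_optimalV [SecondCountableTopology V] {μv : Measure V}
    [IsProbabilityMeasure μv] (h2 : MemLp id 2 μv)
    {τ : ℝ} (hτ : 0 < τ) (σ : ℝ≥0) (m t : ℝ) :
    FiniteEntropy μv (optimalV H d τ μv σ m t) := by
  have hexp := integrable_exp_neg_averagedMisfit H d μv hτ (sq_le_sq_add_mul_exp σ m t)
  have hm := (continuous_averagedMisfit H d τ m (m ^ 2 + σ * Real.exp t)).neg.measurable
  have hp : IsProbabilityMeasure (optimalV H d τ μv σ m t) := isProbabilityMeasure_tilted hexp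
  have hmem : MemLp id 2 (optimalV H d τ μv σ m t) := memLp_two_tilted_of_nonpos hm
    (fun v => neg_nonpos.2 (averagedMisfit_nonneg H d hτ (sq_le_sq_add_mul_exp σ m t) v)) h2
  exact ⟨hp, tilted_absolutelyContinuous _ _, integrable_llr_tilted_self hm hexp
    (averagedMisfit_integrable H d τ hmem _ _).neg, hmem⟩

lemma meanFieldEnergy_optimalV [SecondCountableTopology V] {μv : Measure V}
    [IsProbabilityMeasure μv] (h2 : MemLp id 2 μv)
    {τ : ℝ} (hτ : 0 < τ) (lbar : ℝ) {σ : ℝ≥0} (hσ : σ ≠ 0) (m t : ℝ) :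
    meanFieldEnergy H d τ μv (gaussianReal lbar σ) (optimalV H d τ μv σ m t)
      (gaussianLogVar σ m t) = reducedEnergy H d τ μv lbar σ (m, t) := by
  have hopt := finiteEntropy_optimalV H d h2 hτ σ m t
  have := hopt.prob
  have h := integral_llr_tilted_self
    (f := fun v => -averagedMisfit H d τ m (m ^ 2 + σ * Real.exp t) v)
    (continuous_averagedMisfit H d τ m (m ^ 2 + σ * Real.exp t)).neg.measurable
    (integrable_exp_neg_averagedMisfit H d μv hτ (sq_le_sq_add_mul_exp σ m t))
    (averagedMisfit_integrable H d τ hopt.memLp _ _).neg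
  rw [meanFieldEnergy_gaussianLogVar H d τ μv hopt.memLp lbar hσ, reducedEnergy]
  simp only [integral_neg] at h
  simp only [optimalV]
  linarith

/-- For fixed `ρv` the mean-field energy has a unique minimizer over `ρl`, the Gibbs measure of the
misfit averaged over `ρv`, and this measure is Gaussian. -/
lemma exists_gaussianLogVar_optimal {μv : Measure V} {τ : ℝ} (hτ : 0 < τ) (lbar : ℝ) {σ : ℝ≥0}
    (hσ : σ ≠ 0) {ρv : Measure V} [IsProbabilityMeasure ρv] (hv : MemLp id 2 ρv) :
    ∃ m t : ℝ, gibbs (gaussianReal lbar σ) (fun l => ∫ v, misfit H d τ (v, l) ∂ρv) =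
        gaussianLogVar σ m t ∧
      ∀ ρl, FiniteEntropy (gaussianReal lbar σ) ρl →
        meanFieldEnergy H d τ μv (gaussianReal lbar σ) ρv (gaussianLogVar σ m t) ≤
          meanFieldEnergy H d τ μv (gaussianReal lbar σ) ρv ρl ∧
        (meanFieldEnergy H d τ μv (gaussianReal lbar σ) ρv ρl ≤
          meanFieldEnergy H d τ μv (gaussianReal lbar σ) ρv (gaussianLogVar σ m t) →
          ρl = gaussianLogVar σ m t) := by
  obtain ⟨m, t, hmt⟩ := exists_gaussianLogVar_eq_tilted lbar hσ (τ * ∫ v, ⟪d, H v⟫ ∂ρv)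
    (τ / 2 * ‖d‖ ^ 2) (b := τ * ∫ v, ‖H v‖ ^ 2 ∂ρv)
    (mul_nonneg hτ.le (integral_nonneg fun v => by positivity))
  set ψ : ℝ → ℝ := fun l => ∫ v, misfit H d τ (v, l) ∂ρv with hψ
  have hψ' : ∀ l, ψ l = (τ * ∫ v, ‖H v‖ ^ 2 ∂ρv) * l ^ 2 / 2
      - (τ * ∫ v, ⟪d, H v⟫ ∂ρv) * l + τ / 2 * ‖d‖ ^ 2 := integral_misfit_left H d τ hv
  simp_rw [← hψ'] at hmt
  have hmeas : Measurable ψ := by rw [funext hψ']; fun_prop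
  have hnonneg : ∀ l, 0 ≤ ψ l := fun l => integral_nonneg fun v => misfit_nonneg H d hτ _
  have hexp : Integrable (fun l => Real.exp (-ψ l)) (gaussianReal lbar σ) :=
    integrable_exp_of_nonpos hmeas.neg fun l => neg_nonpos.2 (hnonneg l)
  -- Integrating out `v` turns the energy into the Gibbs functional of the potential `ψ`.
  have henergy : ∀ ρl, FiniteEntropy (gaussianReal lbar σ) ρl →
      meanFieldEnergy H d τ μv (gaussianReal lbar σ) ρv ρl =
        ∫ v, llr ρv μv v ∂ρv + (∫ l, llr ρl (gaussianReal lbar σ) l ∂ρl - ∫ l, -ψ l ∂ρl) ∧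
      Integrable (fun l => -ψ l) ρl := by
    intro ρl hl
    have := hl.prob
    have hi := integrable_misfit_prod H d τ hv hl.memLp
    refine ⟨?_, hi.integral_prod_right.neg⟩
    rw [meanFieldEnergy, integral_prod_symm _ hi, integral_neg]
    ring
  have hopt := finiteEntropy_gaussianLogVar (lbar := lbar) hσ m t
  have hmin := integral_llr_tilted_self (f := fun l => -ψ l) hmeas.neg hexp
    (by rw [hmt]; exact (henergy _ hopt).2)
  rw [hmt] at hmin
  refine ⟨m, t, hmt, fun ρl hl => ?_⟩
  have := hl.prob
  rw [(henergy _ hopt).1, (henergy ρl hl).1, hmin]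
  refine ⟨?_, fun hle => ?_⟩
  · have := neg_log_integral_exp_le hl.ac hl.llr_integrable (henergy ρl hl).2 hexp
    linarith
  · rw [← hmt]
    exact eq_tilted_of_le hl.ac hl.llr_integrable (henergy ρl hl).2 hexp (by linarith)

lemma continuous_reducedEnergy {μv : Measure V} [IsProbabilityMeasure μv] {τ : ℝ} (hτ : 0 < τ)
    (lbar : ℝ) (σ : ℝ≥0) : Continuous (reducedEnergy H d τ μv lbar σ) := by
  have hint : Continuous fun q : ℝ × ℝ =>
      ∫ v, Real.exp (-averagedMisfit H d τ q.1 (q.1 ^ 2 + σ * Real.exp q.2) v) ∂μv := by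
    refine continuous_of_dominated (bound := fun _ => 1) (fun q => ?_) (fun q => ?_)
      (integrable_const _) (ae_of_all _ fun v => ?_)
    · exact (integrable_exp_neg_averagedMisfit H d μv hτ (sq_le_sq_add_mul_exp σ q.1 q.2)).1
    · refine ae_of_all _ fun v => ?_
      simpa using averagedMisfit_nonneg H d hτ (sq_le_sq_add_mul_exp σ q.1 q.2) v
    · unfold averagedMisfit; fun_prop
  unfold reducedEnergy
  refine Continuous.sub (by fun_prop) (hint.log fun q => ?_)
  exact (integral_exp_pos
    (integrable_exp_neg_averagedMisfit H d μv hτ (sq_le_sq_add_mul_exp σ q.1 q.2))).ne'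

/-- The partition function is at most one, so the reduced energy is bounded below by the relative
entropy of `N(m, σ eᵗ)`, which is coercive. -/
lemma le_reducedEnergy {μv : Measure V} [IsProbabilityMeasure μv] {τ : ℝ} (hτ : 0 < τ)
    (lbar : ℝ) {σ : ℝ≥0} (hσ : σ ≠ 0) (q : ℝ × ℝ) :
    (|q.2| - 1 + (2 * |q.1 - lbar| - σ)) / 2 ≤ reducedEnergy H d τ μv lbar σ q := by
  have hσ' : (0 : ℝ) < σ := by positivity
  have hlog : Real.log (∫ v, Real.exp (-averagedMisfit H d τ q.1
      (q.1 ^ 2 + σ * Real.exp q.2) v) ∂μv) ≤ 0 := by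
    refine Real.log_nonpos (integral_nonneg fun v => (Real.exp_pos _).le) ?_
    have h := integral_mono
      (integrable_exp_neg_averagedMisfit H d μv hτ (sq_le_sq_add_mul_exp σ q.1 q.2))
      (integrable_const (1 : ℝ))
      (fun v => by simpa using averagedMisfit_nonneg H d hτ (sq_le_sq_add_mul_exp σ q.1 q.2) v)
    simpa using h
  have hexp : |q.2| - 1 ≤ Real.exp q.2 - 1 - q.2 := by
    rcases le_total 0 q.2 with h | h
    · rw [abs_of_nonneg h]
      nlinarith [Real.quadratic_le_exp_of_nonneg h, sq_nonneg (q.2 - 1)]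
    · rw [abs_of_nonpos h]
      linarith [Real.exp_pos q.2]
  have hsq : 2 * |q.1 - lbar| - σ ≤ (q.1 - lbar) ^ 2 / σ := by
    rw [le_div_iff₀ hσ', ← sq_abs (q.1 - lbar)]
    nlinarith [sq_nonneg (|q.1 - lbar| - σ)]
  unfold reducedEnergy
  linarith

lemma exists_forall_reducedEnergy_le (μv : Measure V) [IsProbabilityMeasure μv] {τ : ℝ}
    (hτ : 0 < τ) (lbar : ℝ) {σ : ℝ≥0} (hσ : σ ≠ 0) :
    ∃ q, ∀ q', reducedEnergy H d τ μv lbar σ q ≤ reducedEnergy H d τ μv lbar σ q' := by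
  refine (continuous_reducedEnergy H d hτ lbar σ).exists_forall_le' (lbar, 0) ?_
  set c := reducedEnergy H d τ μv lbar σ (lbar, 0)
  set R := 2 * c + 1 + σ
  rw [Filter.Eventually, Filter.mem_cocompact]
  refine ⟨Set.Icc (lbar - R) (lbar + R) ×ˢ Set.Icc (-R) R, isCompact_Icc.prod isCompact_Icc, ?_⟩
  intro q hq
  by_contra hlt
  have hlt' : reducedEnergy H d τ μv lbar σ q < c := not_le.1 hlt
  have h := le_reducedEnergy (μv := μv) H d hτ lbar hσ q
  have h1 : |q.2| ≤ R := by linarith [abs_nonneg (q.1 - lbar)]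
  have h2 : |q.1 - lbar| ≤ R := by
    linarith [abs_nonneg (q.1 - lbar), abs_nonneg q.2]
  refine hq ⟨⟨?_, ?_⟩, abs_le.1 h1⟩ <;> linarith [(abs_le.1 h2).1, (abs_le.1 h2).2]

end Energy

/-! ### The conditions on admissible pairs -/

section Conditions

lemma iSup_measure_eq_one {X : Type*} [MeasurableSpace X] {μ : Measure X} [IsProbabilityMeasure μ]
    {T : ℝ → Set X} (hmono : ∀ N M : ℝ, 0 < N → N ≤ M → T N ⊆ T M)
    (hT : ∀ᵐ x ∂μ, ∃ N : ℝ, 0 < N ∧ x ∈ T N) : ⨆ (N : ℝ) (_ : 0 < N), μ (T N) = 1 := by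
  refine le_antisymm (iSup₂_le fun _ _ => prob_le_one) ?_
  have hunion : μ (⋃ k : ℕ, T (k + 1)) = 1 := by
    rw [measure_congr (ae_eq_univ.2 _), measure_univ]
    refine measure_mono_null (fun x hx => ?_) hT
    rintro ⟨N, hN, hxN⟩
    obtain ⟨k, hk⟩ := exists_nat_ge N
    exact hx (Set.mem_iUnion.2 ⟨k, hmono N _ hN (by linarith) hxN⟩)
  have hm : Monotone fun k : ℕ => T (k + 1) := fun i j hij =>
    hmono _ _ (by positivity) (by gcongr)
  rw [← hunion, hm.measure_iUnion]
  exact iSup_le fun k => le_iSup₂_of_le ((k : ℝ) + 1) (by positivity) le_rfl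

lemma annulus_mono {V : Type*} [NormedAddCommGroup V] {N M : ℝ} (hN : 0 < N) (hNM : N ≤ M) :
    annulus V N ⊆ annulus V M := fun _ hv =>
  ⟨(one_div_le_one_div_of_le hN hNM).trans hv.1, hv.2.trans hNM⟩

lemma exists_mem_annulus {V : Type*} [NormedAddCommGroup V] {v : V} (hv : v ≠ 0) :
    ∃ N : ℝ, 0 < N ∧ v ∈ annulus V N := by
  have hpos := norm_pos_iff.2 hv
  refine ⟨max ‖v‖ (1 / ‖v‖), lt_max_of_lt_left hpos, ?_, le_max_left _ _⟩
  rw [one_div_le (lt_max_of_lt_left hpos) hpos]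
  exact le_max_right _ _

/-- A Gaussian measure with positive definite covariance has no atom at the origin, because a
one-dimensional marginal is a nondegenerate Gaussian. -/
lemma IsGaussianWith.measure_singleton_zero {V : Type*} [NormedAddCommGroup V]
    [InnerProductSpace ℝ V] [CompleteSpace V] [SecondCountableTopology V] [MeasurableSpace V]
    [BorelSpace V] [Nontrivial V] {C : V →L[ℝ] V} (hC : ∀ x : V, x ≠ 0 → 0 < ⟪C x, x⟫)
    {μ : Measure V} {m : V} (hμ : IsGaussianWith μ m C) : μ {0} = 0 := by
  obtain ⟨hG, -, hcov⟩ := hμ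
  obtain ⟨x, hx⟩ := exists_ne (0 : V)
  have hvar : 0 < Var[innerSL ℝ x; μ] := by
    have h := covarianceBilin_self (IsGaussian.memLp_two_id (μ := μ)) x
    rw [hcov] at h
    exact lt_of_lt_of_eq (hC x hx) h
  have hmap := IsGaussian.map_eq_gaussianReal (μ := μ) (innerSL ℝ x)
  have := nullSingletonClass_gaussianReal (μ := μ[innerSL ℝ x])
    (v := Var[innerSL ℝ x; μ].toNNReal) (by simpa using hvar)
  have h0 : μ.map (innerSL ℝ x) {0} = 0 := by
    rw [hmap]
    exact measure_singleton 0
  rw [Measure.map_apply (by fun_prop) (measurableSet_singleton 0)] at h0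
  exact measure_mono_null (by simp) h0

variable {V : Type*} [NormedAddCommGroup V] [InnerProductSpace ℝ V] {n : ℕ}
  (H : V →L[ℝ] EuclideanSpace ℝ (Fin n)) (d : EuclideanSpace ℝ (Fin n)) {τ : ℝ}

lemma averagedMisfit_mem_potentialsR1 (hτ : 0 < τ) {m₁ m₂ : ℝ} (h : m₁ ^ 2 ≤ m₂) :
    averagedMisfit H d τ m₁ m₂ ∈ PotentialsR1 (annulus V) := by
  intro N _
  refine ⟨τ * (‖d‖ ^ 2 + m₂ * (‖H‖ * N) ^ 2), ?_⟩
  rintro _ ⟨v, hv, rfl⟩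
  have hm := (sq_nonneg m₁).trans h
  refine (averagedMisfit_le H d hτ h v).trans ?_
  gcongr
  exact hv.2

/-- For a nonnegative function, uniform bounds on the integrals over a fibre yield the same bounds
for the lower integrals of its restriction to `{0 ≤ Φ}`. -/
lemma iSup_lintegral_indicator_lt_top {A B X : Type*} [MeasurableSpace B] {ν : Measure B}
    {Φ : X → ℝ} (hΦ : ∀ p, 0 ≤ Φ p) (i : A → B → X)
    (hint : ∀ a, Integrable (fun b => Φ (i a b)) ν) {s : Set A}
    (hb : BddAbove ((fun a => ∫ b, Φ (i a b) ∂ν) '' s)) :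
    ⨆ a ∈ s, ∫⁻ b, ENNReal.ofReal ({p | 0 ≤ Φ p}.indicator Φ (i a b)) ∂ν < ⊤ := by
  obtain ⟨c, hc⟩ := hb
  refine lt_of_le_of_lt (iSup₂_le fun a ha => ?_) (ENNReal.ofReal_lt_top (r := c))
  have h : ∀ b, {p | 0 ≤ Φ p}.indicator Φ (i a b) = Φ (i a b) := fun b =>
    Set.indicator_of_mem (s := {p | 0 ≤ Φ p}) (hΦ _) Φ
  simp_rw [h]
  rw [← ofReal_integral_eq_lintegral_ofReal (hint a) (ae_of_all _ fun b => hΦ _)]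
  exact ENNReal.ofReal_le_ofReal (hc ⟨a, ha, rfl⟩)

variable [MeasurableSpace V] [BorelSpace V]

lemma continuous_integral_misfit_left {ρv : Measure V} [IsProbabilityMeasure ρv]
    (hv : MemLp id 2 ρv) : Continuous fun l => ∫ v, misfit H d τ (v, l) ∂ρv := by
  rw [funext (integral_misfit_left H d τ hv)]
  fun_prop

lemma meanFieldConditions_misfit [SecondCountableTopology V] (hτ : 0 < τ) {μv νv : Measure V}
    {μl νl : Measure ℝ} [IsProbabilityMeasure μv] [IsProbabilityMeasure νv]
    [IsProbabilityMeasure μl] [IsProbabilityMeasure νl] (h0 : μv {0} = 0) (hμv : MemLp id 2 μv)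
    (hμl : MemLp id 2 μl) (hνv : MemLp id 2 νv) (hνl : MemLp id 2 νl) :
    MeanFieldConditions (misfit H d τ) μv μl νv νl where
  exhaust_v := iSup_measure_eq_one (fun _ _ => annulus_mono) <|
    (measure_eq_zero_iff_ae_notMem.1 h0).mono fun _ hv => exists_mem_annulus hv
  exhaust_l := iSup_measure_eq_one
    (fun _ _ _ h => Set.Icc_subset_Icc (neg_le_neg h) h) <| ae_of_all _ fun l =>
      ⟨|l| + 1, by positivity, abs_le.1 (by linarith)⟩
  T1 N hN := by
    refine iSup_lintegral_indicator_lt_top (misfit_nonneg H d hτ) (fun v l => (v, l))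
      (integrable_misfit_right H d τ hνl) ?_
    simp_rw [integral_misfit_right H d τ hνl]
    exact averagedMisfit_mem_potentialsR1 H d hτ (sq_integral_le hνl) N hN
  T2 N _ := iSup_lintegral_indicator_lt_top (misfit_nonneg H d hτ) (fun l v => (v, l))
    (integrable_misfit_left H d τ hνv)
    (isCompact_Icc.bddAbove_image (continuous_integral_misfit_left H d hνv).continuousOn)
  T3 := mem_potentialsR2_of_nonneg hμv fun v => integral_nonneg fun _ => misfit_nonneg H d hτ _
  T4 := by
    have h := mem_potentialsR2_of_nonneg hμl (φ := fun l => ∫ v, misfit H d τ (v, l) ∂νv)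
      fun l => integral_nonneg fun _ => misfit_nonneg H d hτ _
    simpa only [PotentialsR2, Set.mem_ofPred_eq, Real.norm_eq_abs, sq_abs] using h

end Conditions

/-! ### Existence and structure of the minimizer -/

section Minimizer

lemma hasPotential_gibbs_of_nonneg {X : Type*} [MeasurableSpace X] {μ₀ : Measure X}
    [IsFiniteMeasure μ₀] {φ : X → ℝ} (hm : Measurable φ) (h0 : ∀ x, 0 ≤ φ x) :
    HasPotential μ₀ φ (gibbs μ₀ φ) :=
  ⟨hm, integrable_exp_of_nonpos hm.neg fun x => neg_nonpos.2 (h0 x), rfl⟩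

lemma gibbs_mem_admissibleSet {X : Type*} [NormedAddCommGroup X] [MeasurableSpace X]
    [BorelSpace X] [SecondCountableTopology X] {T : ℝ → Set X} {μ₀ : Measure X}
    [IsProbabilityMeasure μ₀] (h2 : MemLp id 2 μ₀) {φ : X → ℝ} (hm : Measurable φ)
    (h0 : ∀ x, 0 ≤ φ x) (hφ : φ ∈ PotentialsR1 T) : gibbs μ₀ φ ∈ AdmissibleSet T μ₀ := by
  have hp := hasPotential_gibbs_of_nonneg (μ₀ := μ₀) hm h0
  exact ⟨isProbabilityMeasure_tilted hp.2.1, tilted_absolutelyContinuous _ _,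
    absolutelyContinuous_tilted hp.2.1, φ, ⟨hφ, mem_potentialsR2_of_nonneg h2 h0⟩, hp⟩

variable {V : Type*} [NormedAddCommGroup V] [InnerProductSpace ℝ V] {n : ℕ}
  (H : V →L[ℝ] EuclideanSpace ℝ (Fin n)) (d : EuclideanSpace ℝ (Fin n)) {τ : ℝ}
  [MeasurableSpace V] [BorelSpace V]

/-- The product of `N(m, σ eᵗ)` and its optimal partner, at a minimizer `(m, t)` of the reduced
energy, minimizes the mean-field energy among all pairs, and its second factor is the Gibbs measure
of the misfit averaged over the first. -/
lemma exists_meanFieldEnergy_minimizer [SecondCountableTopology V] {μv : Measure V}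
    [IsProbabilityMeasure μv] (h2 : MemLp id 2 μv) (hτ : 0 < τ) (lbar : ℝ) {σ : ℝ≥0}
    (hσ : σ ≠ 0) :
    ∃ m t : ℝ,
      (∀ ρv ρl, FiniteEntropy μv ρv → FiniteEntropy (gaussianReal lbar σ) ρl →
        meanFieldEnergy H d τ μv (gaussianReal lbar σ) (optimalV H d τ μv σ m t)
          (gaussianLogVar σ m t) ≤ meanFieldEnergy H d τ μv (gaussianReal lbar σ) ρv ρl) ∧
      gaussianLogVar σ m t = gibbs (gaussianReal lbar σ)
        (fun l => ∫ v, misfit H d τ (v, l) ∂optimalV H d τ μv σ m t) := by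
  obtain ⟨⟨m, t⟩, hmin⟩ := exists_forall_reducedEnergy_le H d μv hτ lbar hσ
  have hGauss : ∀ ρv, FiniteEntropy μv ρv → ∀ m' t',
      meanFieldEnergy H d τ μv (gaussianReal lbar σ) (optimalV H d τ μv σ m t)
        (gaussianLogVar σ m t) ≤
      meanFieldEnergy H d τ μv (gaussianReal lbar σ) ρv (gaussianLogVar σ m' t') := by
    intro ρv hv m' t'
    rw [meanFieldEnergy_optimalV H d h2 hτ lbar hσ]
    exact (hmin (m', t')).trans (reducedEnergy_le H d hτ lbar hσ m' t' hv)
  refine ⟨m, t, fun ρv ρl hv hl => ?_, ?_⟩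
  · have := hv.prob
    obtain ⟨m', t', -, h⟩ := exists_gaussianLogVar_optimal H d (μv := μv) hτ lbar hσ hv.memLp
    exact (hGauss ρv hv m' t').trans (h ρl hl).1
  · have hopt := finiteEntropy_optimalV H d h2 hτ σ m t
    have := hopt.prob
    obtain ⟨m', t', h, h'⟩ := exists_gaussianLogVar_optimal H d (μv := μv) hτ lbar hσ hopt.memLp
    rw [h]
    exact (h' _ (finiteEntropy_gaussianLogVar hσ m t)).2 (hGauss _ hopt m' t')

/-- Minimizing the mean-field energy amounts to minimizing the relative entropy with respect to the
posterior; pairs of infinite relative entropy do not matter. -/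
lemma klDiv_le_of_meanFieldEnergy_le {μv : Measure V} {μl : Measure ℝ} [IsProbabilityMeasure μv]
    [IsProbabilityMeasure μl] (hτ : 0 < τ) {νv : Measure V} {νl : Measure ℝ}
    (hνv : FiniteEntropy μv νv) (hνl : FiniteEntropy μl νl)
    (hmin : ∀ ρv ρl, FiniteEntropy μv ρv → FiniteEntropy μl ρl →
      meanFieldEnergy H d τ μv μl νv νl ≤ meanFieldEnergy H d τ μv μl ρv ρl)
    {ρv : Measure V} {ρl : Measure ℝ} [IsProbabilityMeasure ρv] [IsProbabilityMeasure ρl]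
    (hv : ρv ≪ μv) (hl : ρl ≪ μl) (hv2 : MemLp id 2 ρv) (hl2 : MemLp id 2 ρl) :
    klDiv (νv.prod νl) (gibbs (μv.prod μl) (misfit H d τ)) ≤
      klDiv (ρv.prod ρl) (gibbs (μv.prod μl) (misfit H d τ)) := by
  have := hνv.prob
  have := hνl.prob
  by_cases htop : klDiv (ρv.prod ρl) (gibbs (μv.prod μl) (misfit H d τ)) = ⊤
  · rw [htop]; exact le_top
  have hexp : Integrable (fun p => Real.exp (-misfit H d τ p)) (μv.prod μl) :=
    integrable_exp_of_nonpos (continuous_misfit H d τ).measurable.neg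
      fun p => neg_nonpos.2 (misfit_nonneg H d hτ p)
  have hρ := integrable_misfit_prod H d τ hv2 hl2
  have hν := integrable_misfit_prod H d τ hνv.memLp hνl.memLp
  rw [gibbs_eq_tilted] at htop ⊢
  obtain ⟨hiv, hil⟩ := integrable_llr_of_klDiv_tilted_ne_top hv hl hρ.neg hexp htop
  rw [klDiv_prod_tilted hνv.ac hνl.ac hνv.llr_integrable hνl.llr_integrable
    (f := fun p => -misfit H d τ p) hν.neg hexp,
    klDiv_prod_tilted hv hl hiv hil (f := fun p => -misfit H d τ p) hρ.neg hexp]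
  refine ENNReal.ofReal_le_ofReal ?_
  have h := hmin ρv ρl ⟨inferInstance, hv, hiv, hv2⟩ ⟨inferInstance, hl, hil, hl2⟩
  simp only [meanFieldEnergy] at h
  simp only [integral_neg]
  linarith

end Minimizer

theorem theorem2p2 {V : Type*} [NormedAddCommGroup V] [InnerProductSpace ℝ V] [CompleteSpace V]
    [TopologicalSpace.SeparableSpace V] [MeasurableSpace V] [BorelSpace V] [Nontrivial V]
    {n : ℕ} (H : V →L[ℝ] EuclideanSpace ℝ (Fin n)) (d : EuclideanSpace ℝ (Fin n))
    (τ : ℝ) (hτ : 0 < τ)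
    (C₀ : V →L[ℝ] V) (hC₀ : ∀ x : V, x ≠ 0 → 0 < ⟪C₀ x, x⟫)
    (μv : Measure V) (hμv : IsGaussianWith μv 0 C₀)
    (lbar : ℝ) (σ : ℝ≥0) (hσ : 0 < σ)
    (μl : Measure ℝ) (hμl : μl = gaussianReal lbar σ)
    (μ : Measure (V × ℝ)) (hμ : μ = gibbs (μv.prod μl) (misfit H d τ)) :
    (∀ νv ∈ AdmissibleV μv, ∀ νl ∈ AdmissibleL μl,
      MeanFieldConditions (misfit H d τ) μv μl νv νl) ∧
    ∃ (νv : Measure V) (νl : Measure ℝ) (φv : V → ℝ) (φl : ℝ → ℝ) (cv cl : ℝ),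
      IsMeanFieldSolution (AdmissibleV μv) (AdmissibleL μl) μ νv νl ∧
      (∀ v : V, Integrable (fun l => misfit H d τ (v, l)) νl ∧
        φv v = ∫ l, misfit H d τ (v, l) ∂νl + cv) ∧
      (∀ l : ℝ, Integrable (fun v => misfit H d τ (v, l)) νv ∧
        φl l = ∫ v, misfit H d τ (v, l) ∂νv + cl) ∧
      HasPotential (μv.prod μl) (fun p => φv p.1 + φl p.2) (νv.prod νl) ∧
      HasPotential μv φv νv ∧ HasPotential μl φl νl := by
  have : SecondCountableTopology V := UniformSpace.secondCountable_of_separable V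
  have hG : IsGaussian μv := hμv.1
  have h0 := hμv.measure_singleton_zero hC₀
  have hv2 : MemLp id 2 μv := IsGaussian.memLp_two_id
  subst hμl hμ
  have hl2 : MemLp id 2 (gaussianReal lbar σ) := memLp_id_gaussianReal 2
  refine ⟨fun νv hνv νl hνl => ?_, ?_⟩
  · have := hνv.1
    have := hνl.1
    exact meanFieldConditions_misfit H d hτ h0 hv2 hl2 (memLp_two_of_mem_admissibleSet hνv)
      (memLp_two_of_mem_admissibleSet hνl)
  obtain ⟨m, t, hmin, hfix⟩ := exists_meanFieldEnergy_minimizer H d hv2 hτ lbar hσ.ne'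
  set νv := optimalV H d τ μv σ m t with hνv
  set νl := gaussianLogVar σ m t with hνl
  have hνvE : FiniteEntropy μv νv := finiteEntropy_optimalV H d hv2 hτ σ m t
  have hνlE : FiniteEntropy (gaussianReal lbar σ) νl := finiteEntropy_gaussianLogVar hσ.ne' m t
  have := hνvE.prob
  have hφv : ∀ v, ∫ l, misfit H d τ (v, l) ∂νl =
      averagedMisfit H d τ m (m ^ 2 + σ * Real.exp t) v := fun v => by
    rw [integral_misfit_right H d τ hνlE.memLp, hνl, integral_id_gaussianLogVar,
      integral_sq_gaussianLogVar]
  have hnonneg_v := averagedMisfit_nonneg H d hτ (sq_le_sq_add_mul_exp σ m t)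
  have hnonneg_l : ∀ l, 0 ≤ ∫ v, misfit H d τ (v, l) ∂νv :=
    fun l => integral_nonneg fun v => misfit_nonneg H d hτ _
  have hcont_v := continuous_averagedMisfit H d τ m (m ^ 2 + σ * Real.exp t)
  have hcont_l := continuous_integral_misfit_left H d (τ := τ) hνvE.memLp
  have hpot_v : HasPotential μv (averagedMisfit H d τ m (m ^ 2 + σ * Real.exp t)) νv :=
    hasPotential_gibbs_of_nonneg hcont_v.measurable hnonneg_v
  have hpot_l : HasPotential (gaussianReal lbar σ) (fun l => ∫ v, misfit H d τ (v, l) ∂νv) νl := by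
    rw [hfix]
    exact hasPotential_gibbs_of_nonneg hcont_l.measurable hnonneg_l
  refine ⟨νv, νl, _, _, 0, 0, ⟨?_, ?_, ?_⟩,
    fun v => ⟨integrable_misfit_right H d τ hνlE.memLp v, ((add_zero _).trans (hφv v)).symm⟩,
    fun l => ⟨integrable_misfit_left H d τ hνvE.memLp l, (add_zero _).symm⟩,
    hpot_v.prod hpot_l, hpot_v, hpot_l⟩
  · exact gibbs_mem_admissibleSet hv2 hcont_v.measurable hnonneg_v
      (averagedMisfit_mem_potentialsR1 H d hτ (sq_le_sq_add_mul_exp σ m t))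
  · rw [hfix]
    exact gibbs_mem_admissibleSet hl2 hcont_l.measurable hnonneg_l
      fun N _ => isCompact_Icc.bddAbove_image hcont_l.continuousOn
  · intro ρv hρv ρl hρl
    have := hρv.1
    have := hρl.1
    exact klDiv_le_of_meanFieldEnergy_le H d hτ hνvE hνlE hmin hρv.2.1 hρl.2.1
      (memLp_two_of_mem_admissibleSet hρv) (memLp_two_of_mem_admissibleSet hρl)
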